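/- Let $A$ be a bounded distributive lattice and let ${\prec}\subseteq A\times A$ be a subordination relation, i.e. for all $a,b,x,y\in A$: $\bot\prec\bot$; $\top\prec\top$; $a\le b\prec x$ implies $a\prec x$; $b\prec x\le y$ implies $b\prec y$; $a\prec x$ and $a\prec y$ imply $a\prec x\wedge y$; $a\prec x$ and $b\prec x$ imply $a\vee b\prec x$. Let $A^\delta$ be the canonical extension of $A$, i.e. a complete lattice that contains $A$ as a dense and compact subposet, and let $J=J^\infty(A^\delta)$ be the set of its completely join-irreducible elements, ordered as in $A^\delta$. Let $\Diamond$ be defined by $\Diamond a=\bigwedge\{b\in A\mid a\prec b\}$ for $a\in A$, $\Diamond k=\bigwedge\{\Diamond a\mid a\in A,\ k\le a\}$ for $k\in A^\delta$ closed (a meet of a nonempty down-directed subset of $A$), and $\Diamond u=\bigvee\{\Diamond k\mid k \text{ closed},\ k\le u\}$ for $u\in A^\delta$. For $j,i\in J$ write $j\,R_\prec\, i$ iff $i\le\Diamond j$. Consider the following conditions on $\prec$, for all $a,b,c,x\in A$: - (CT) $a\prec b$ and $a\wedge b\prec c$ imply $a\prec c$; - (S9) $\exists c\,(c\prec b\ \&\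 x\prec a\vee c)$ if and only if $\exists a'\exists b'\,(a'\prec a\ \&\ b'\prec b\ \&\ x\le a'\vee b')$; - (SL1) $a\prec b\vee c$ implies $\exists b'\exists c'\,(b'\prec b\ \&\ c'\prec c\ \&\ a\prec b'\vee c')$; - (SL2) $b\wedge c\prec a$ implies $\exists b'\exists c'\,(b\prec b'\ \&\ c\prec c'\ \&\ b'\wedge c'\prec a)$. Then, with $i,j,k,i_1,i_2,i_3,i_4$ ranging over $J$: 1. (CT) holds iff for all $j,i$: if $j R_\prec i$, then $j R_\prec k$ and $k R_\prec i$ for some $k\le j$. 2. (S9) holds iff for all $i_1,i_2,i_3$: $\;i_3R_\prec i_1$ and $i_3R_\prec i_2$ $\iff$ there is $j\ge i_1$ with $jR_\prec i_2$ and $i_3R_\prec j$. 3. (SL1) holds iff for all $i_1,i_2,i_3,i_4$: if $i_4R_\prec i_1$, $i_4R_\prec i_2$ and $i_3R_\prec i_4$, then there is $j\ge i_1\vee i_2$ with $i_3R_\prec j$. 4. (SL2) holds iff for all $i_1,i_2,i_3,i_4$: if $i_1R_\prec i_4$, $i_2R_\prec i_4$ and $i_4R_\prec i_3$, then there is $j\le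 i_1\wedge i_2$ with $jR_\prec i_3$. -/

import Mathlib

namespace SubordinationLattice

universe u v

section CanonicalExtension

variable {A : Type u} {C : Type v}

/-- A closed element of `C`: the meet of a (nonempty) down-directed subset of `A`,
where `A` is regarded as a subposet of `C` along `e`. -/
def IsClosedElt [PartialOrder A] [CompleteLattice C] (e : A ↪o C) (k : C) : Prop :=
  ∃ F : Set A, F.Nonempty ∧ DirectedOn (· ≥ ·) F ∧ k = sInf (e '' F)

/-- An open element of `C`: the join of a (nonempty) up-directed subset of `A`. -/
def IsOpenElt [PartialOrder A] [CompleteLattice C] (e : A ↪o C) (o : C) : Prop :=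
  ∃ I : Set A, I.Nonempty ∧ DirectedOn (· ≤ ·) I ∧ o = sSup (e '' I)

/-- `e : A ↪o C` exhibits the complete lattice `C` as the canonical extension of the poset `A`:
`A` is dense and compact in `C`. -/
structure IsCanonicalExtension [PartialOrder A] [CompleteLattice C] (e : A ↪o C) : Prop where
  dense_closed : ∀ u : C, ∃ S : Set C, (∀ k ∈ S, IsClosedElt e k) ∧ u = sSup S
  dense_open : ∀ u : C, ∃ T : Set C, (∀ o ∈ T, IsOpenElt e o) ∧ u = sInf T
  compact : ∀ F I : Set A, F.Nonempty → DirectedOn (· ≥ ·) F →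
    I.Nonempty → DirectedOn (· ≤ ·) I →
    sInf (e '' F) ≤ sSup (e '' I) → ∃ a ∈ F, ∃ b ∈ I, a ≤ b

/-- Completely join-irreducible elements of a complete lattice
(the bottom element is excluded by `S = ∅`). -/
def CompletelyJoinIrreducible [CompleteLattice C] (j : C) : Prop :=
  ∀ S : Set C, j = sSup S → j ∈ S

/-- `J^∞(C)`, with the order induced by `C`. -/
abbrev JInf (C : Type v) [CompleteLattice C] : Type v :=
  {j : C // CompletelyJoinIrreducible j}

end CanonicalExtension

section Subordination

variable {A : Type u}

/-- Subordination relations on a bounded distributive lattice. -/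
structure IsSubordination [DistribLattice A] [BoundedOrder A] (r : A → A → Prop) : Prop where
  bot : r ⊥ ⊥
  top : r ⊤ ⊤
  si : ∀ a b x, a ≤ b → r b x → r a x
  wo : ∀ b x y, r b x → x ≤ y → r b y
  and : ∀ a x y, r a x → r a y → r a (x ⊓ y)
  or : ∀ a b x, r a x → r b x → r (a ⊔ b) x

/-- (CT): `a ≺ b` and `a ∧ b ≺ c` imply `a ≺ c`. -/
def CT [Lattice A] (r : A → A → Prop) : Prop :=
  ∀ a b c, r a b → r (a ⊓ b) c → r a c

/-- (S9). -/
def S9 [Lattice A] (r : A → A → Prop) : Prop :=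
  ∀ a b x, (∃ c, r c b ∧ r x (a ⊔ c)) ↔ ∃ a' b', r a' a ∧ r b' b ∧ x ≤ a' ⊔ b'

/-- (SL1). -/
def SL1 [Lattice A] (r : A → A → Prop) : Prop :=
  ∀ a b c, r a (b ⊔ c) → ∃ b' c', r b' b ∧ r c' c ∧ r a (b' ⊔ c')

/-- (SL2), the order dual of (SL1). -/
def SL2 [Lattice A] (r : A → A → Prop) : Prop :=
  ∀ a b c, r (b ⊓ c) a → ∃ b' c', r b b' ∧ r c c' ∧ r (b' ⊓ c') a

end Subordination

section SubordinationSpace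

variable {A : Type u} {C : Type v}

/-- The slanted operator `◇ a = ⋀ {b ∣ a ≺ b}`, from `A` to `C`. -/
def dia [PartialOrder A] [CompleteLattice C] (e : A ↪o C) (r : A → A → Prop) (a : A) : C :=
  sInf (e '' {b | r a b})

/-- The extension of `◇` to closed elements: `◇ k = ⋀ {◇ a ∣ a ∈ A, k ≤ a}`. -/
def diaClosed [PartialOrder A] [CompleteLattice C] (e : A ↪o C) (r : A → A → Prop) (k : C) : C :=
  sInf (dia e r '' {a | k ≤ e a})

/-- The `σ`-extension of `◇` to `C`: `◇ u = ⋁ {◇ k ∣ k closed, k ≤ u}`. -/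
def diaSigma [PartialOrder A] [CompleteLattice C] (e : A ↪o C) (r : A → A → Prop) (u : C) : C :=
  sSup (diaClosed e r '' {k | IsClosedElt e k ∧ k ≤ u})

/-- The relation `R_≺` of the subordination space: `j R_≺ i` iff `i ≤ ◇ j`. -/
def SubRel [PartialOrder A] [CompleteLattice C] (e : A ↪o C) (r : A → A → Prop)
    (j i : JInf C) : Prop :=
  i.1 ≤ diaSigma e r j.1

end SubordinationSpace

section Existence

variable (A : Type u) [PartialOrder A]

abbrev DownDirected : Type u := {F : Set A // F.Nonempty ∧ DirectedOn (· ≥ ·) F}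

abbrev UpDirected : Type u := {I : Set A // I.Nonempty ∧ DirectedOn (· ≤ ·) I}

/-- The polarity whose concept lattice is the canonical extension of `A`. -/
def Meets (F : DownDirected A) (I : UpDirected A) : Prop :=
  ∃ a ∈ F.1, ∃ b ∈ I.1, a ≤ b

variable {A}

def downPt (a : A) : DownDirected A :=
  ⟨{a}, Set.singleton_nonempty a, by
    rintro _ rfl _ rfl; exact ⟨_, rfl, le_rfl, le_rfl⟩⟩

def upPt (a : A) : UpDirected A :=
  ⟨{a}, Set.singleton_nonempty a, by
    rintro _ rfl _ rfl; exact ⟨_, rfl, le_rfl, le_rfl⟩⟩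

theorem mem_intent_pt (a : A) (I : UpDirected A) :
    I ∈ (Concept.ofObject (Meets A) (downPt a)).intent ↔ ∃ b ∈ I.1, a ≤ b := by
  simp [Meets, downPt]

theorem mem_extent_pt (a : A) (F : DownDirected A) :
    F ∈ (Concept.ofObject (Meets A) (downPt a)).extent ↔ ∃ b ∈ F.1, b ≤ a := by
  rw [← Concept.lowerPolar_intent]
  constructor
  · intro h
    have h1 : Meets A F (upPt a) := h ((mem_intent_pt a (upPt a)).2 ⟨a, rfl, le_rfl⟩)
    obtain ⟨x, hx, y, rfl, hxy⟩ := h1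
    exact ⟨x, hx, hxy⟩
  · rintro ⟨b, hb, hba⟩ I hI
    obtain ⟨c, hc, hac⟩ := (mem_intent_pt a I).1 hI
    exact ⟨b, hb, c, hc, hba.trans hac⟩

/-- The embedding of `A` in the concept lattice of `Meets A`. -/
def conceptEmbedding (A : Type u) [PartialOrder A] :
    A ↪o Concept (DownDirected A) (UpDirected A) (Meets A) :=
  OrderEmbedding.ofMapLEIff (fun a => Concept.ofObject (Meets A) (downPt a)) (by
    intro a b
    rw [← Concept.extent_subset_extent_iff]
    constructor
    · intro h
      obtain ⟨c, rfl, hc⟩ := (mem_extent_pt b (downPt a)).1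
        (h ((mem_extent_pt a (downPt a)).2 ⟨a, rfl, le_rfl⟩))
      exact hc
    · intro h F hF
      obtain ⟨c, hc, hca⟩ := (mem_extent_pt a F).1 hF
      exact (mem_extent_pt b F).2 ⟨c, hc, hca.trans h⟩)

theorem sInf_conceptEmbedding (F : DownDirected A) :
    sInf (conceptEmbedding A '' F.1) = Concept.ofObject (Meets A) F := by
  apply le_antisymm
  · rw [← Concept.intent_subset_intent_iff]
    intro I hI
    obtain ⟨a, ha, b, hb, hab⟩ : Meets A F I := by simpa using hI
    have h1 : sInf (conceptEmbedding A '' F.1) ≤ conceptEmbedding A a :=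
      sInf_le ⟨a, ha, rfl⟩
    exact Concept.intent_subset_intent_iff.2 h1 ((mem_intent_pt a I).2 ⟨b, hb, hab⟩)
  · refine le_sInf ?_
    rintro _ ⟨a, ha, rfl⟩
    rw [Concept.ofObjects_le_iff, Set.singleton_subset_iff]
    exact (mem_extent_pt a F).2 ⟨a, ha, le_rfl⟩

theorem sSup_conceptEmbedding (I : UpDirected A) :
    sSup (conceptEmbedding A '' I.1) = Concept.ofAttribute (Meets A) I := by
  apply le_antisymm
  · refine sSup_le ?_
    rintro _ ⟨a, ha, rfl⟩
    rw [Concept.le_ofAttributes_iff, Set.singleton_subset_iff]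
    exact (mem_intent_pt a I).2 ⟨a, ha, le_rfl⟩
  · rw [← Concept.extent_subset_extent_iff]
    intro F hF
    obtain ⟨a, ha, b, hb, hab⟩ : Meets A F I := by simpa using hF
    have h1 : conceptEmbedding A b ≤ sSup (conceptEmbedding A '' I.1) :=
      le_sSup ⟨b, hb, rfl⟩
    exact Concept.extent_subset_extent_iff.2 h1 ((mem_extent_pt b F).2 ⟨a, ha, hab⟩)

/-- Every poset has a canonical extension. -/
theorem exists_isCanonicalExtension (A : Type u) [PartialOrder A] :
    ∃ (C : Type u) (_ : CompleteLattice C) (e : A ↪o C), IsCanonicalExtension e := by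
  refine ⟨Concept (DownDirected A) (UpDirected A) (Meets A), inferInstance,
    conceptEmbedding A, ?_, ?_, ?_⟩
  · intro u
    refine ⟨(fun F => Concept.ofObject (Meets A) F) '' u.extent, ?_, ?_⟩
    · rintro _ ⟨F, -, rfl⟩
      exact ⟨F.1, F.2.1, F.2.2, (sInf_conceptEmbedding F).symm⟩
    · apply le_antisymm
      · rw [← Concept.extent_subset_extent_iff]
        intro F hF
        have h1 : Concept.ofObject (Meets A) F ≤
            sSup ((fun F => Concept.ofObject (Meets A) F) '' u.extent) :=
          le_sSup ⟨F, hF, rfl⟩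
        rwa [Concept.ofObjects_le_iff, Set.singleton_subset_iff] at h1
      · refine sSup_le ?_
        rintro _ ⟨F, hF, rfl⟩
        rwa [Concept.ofObjects_le_iff, Set.singleton_subset_iff]
  · intro u
    refine ⟨(fun I => Concept.ofAttribute (Meets A) I) '' u.intent, ?_, ?_⟩
    · rintro _ ⟨I, -, rfl⟩
      exact ⟨I.1, I.2.1, I.2.2, (sSup_conceptEmbedding I).symm⟩
    · apply le_antisymm
      · refine le_sInf ?_
        rintro _ ⟨I, hI, rfl⟩
        rwa [Concept.le_ofAttributes_iff, Set.singleton_subset_iff]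
      · rw [← Concept.intent_subset_intent_iff]
        intro I hI
        have h1 : sInf ((fun I => Concept.ofAttribute (Meets A) I) '' u.intent) ≤
            Concept.ofAttribute (Meets A) I :=
          sInf_le ⟨I, hI, rfl⟩
        rwa [Concept.le_ofAttributes_iff, Set.singleton_subset_iff] at h1
  · intro F I hF hF' hI hI' h
    have h1 := sInf_conceptEmbedding (⟨F, hF, hF'⟩ : DownDirected A)
    have h2 := sSup_conceptEmbedding (⟨I, hI, hI'⟩ : UpDirected A)
    simp only at h1 h2
    rw [h1, h2, Concept.ofObject_le_ofAttribute_iff] at h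
    exact h

end Existence

end SubordinationLattice

open scoped SetFamily

/-! Sending `j` in `J` to its trace, the set of elements of `A` above `j`, identifies `J` with the
prime filters of `A`, order reversed: traces are prime (`mem_or_mem_trace`), and every prime filter
is a trace (`exists_trace_eq_compl`). Under this reading `j R i` says that everything `≺`-above a
member of the trace of `j` lies in the trace of `i` (`subRel_iff`).

The axioms of a subordination make `≺`-images of filters closed under meets and `≺`-preimages of
ideals closed under joins. So the point demanded by each first-order condition is a prime filter
containing one such set and avoiding another. It exists by `exists_trace_separating`, and the
lattice condition on `≺` supplies the disjointness needed there. Conversely, a failure of the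
lattice condition is itself a disjointness, and the prime filters separating the two sets refute the
first-order condition. -/

namespace SubordinationLattice

universe u v

/-! ### Completely join-irreducible elements as prime filters -/

section Trace

variable {A : Type u} {C : Type v}

/-- The elements of `A` above `u`. -/
def trace [PartialOrder A] [CompleteLattice C] (e : A ↪o C) (u : C) : Set A :=
  {a | u ≤ e a}

theorem mem_trace [PartialOrder A] [CompleteLattice C] {e : A ↪o C} {u : C} {a : A} :
    a ∈ trace e u ↔ u ≤ e a := Iff.rfl

theorem isUpperSet_trace [PartialOrder A] [CompleteLattice C] (e : A ↪o C) (u : C) :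
    IsUpperSet (trace e u) :=
  fun _ _ hab ha => le_trans ha (e.monotone hab)

theorem IsClosedElt.sInf_trace [PartialOrder A] [CompleteLattice C] {e : A ↪o C} {k : C}
    (hk : IsClosedElt e k) : sInf (e '' trace e k) = k := by
  apply le_antisymm
  · obtain ⟨F, -, -, rfl⟩ := hk
    exact sInf_le_sInf (Set.image_mono fun a ha => sInf_le ⟨a, ha, rfl⟩)
  · refine le_sInf ?_
    rintro _ ⟨a, ha, rfl⟩
    exact ha

theorem IsClosedElt.le_iff_trace_subset [PartialOrder A] [CompleteLattice C] {e : A ↪o C}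
    {k l : C} (hl : IsClosedElt e l) : k ≤ l ↔ trace e l ⊆ trace e k := by
  constructor
  · exact fun h a ha => h.trans ha
  · intro h
    rw [← hl.sInf_trace]
    refine le_sInf ?_
    rintro _ ⟨a, ha, rfl⟩
    exact h ha

namespace IsCanonicalExtension

section PartialOrder

variable [PartialOrder A] [CompleteLattice C] {e : A ↪o C}

theorem le_of_closed_le (he : IsCanonicalExtension e) {u v : C}
    (h : ∀ k, IsClosedElt e k → k ≤ u → k ≤ v) : u ≤ v := by
  obtain ⟨S, hS, rfl⟩ := he.dense_closed u
  exact sSup_le fun k hk => h k (hS k hk) (le_sSup hk)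

theorem le_of_le_open (he : IsCanonicalExtension e) {u v : C}
    (h : ∀ o, IsOpenElt e o → v ≤ o → u ≤ o) : u ≤ v := by
  obtain ⟨T, hT, rfl⟩ := he.dense_open v
  exact le_sInf fun o ho => h o (hT o ho) (sInf_le ho)

theorem isClosedElt (he : IsCanonicalExtension e) (j : JInf C) : IsClosedElt e j.1 := by
  obtain ⟨S, hS, hj⟩ := he.dense_closed j.1
  exact hS _ (j.2 S hj)

theorem sInf_le_iff (he : IsCanonicalExtension e) {F : Set A} (hF : F.Nonempty)
    (hF' : DirectedOn (· ≥ ·) F) {a : A} : sInf (e '' F) ≤ e a ↔ ∃ f ∈ F, f ≤ a := by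
  constructor
  · intro h
    obtain ⟨f, hf, b, rfl, hb⟩ := he.compact F {a} hF hF' (Set.singleton_nonempty a)
      (by rintro _ rfl _ rfl; exact ⟨_, rfl, le_rfl, le_rfl⟩) (by simpa using h)
    exact ⟨f, hf, hb⟩
  · rintro ⟨f, hf, hfa⟩
    exact (sInf_le (Set.mem_image_of_mem e hf)).trans (e.monotone hfa)

theorem map_bot [OrderBot A] (he : IsCanonicalExtension e) : e ⊥ = ⊥ := by
  refine le_bot_iff.1 (he.le_of_le_open ?_)
  rintro _ ⟨I, ⟨a, ha⟩, -, rfl⟩ -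
  exact (e.monotone bot_le).trans (le_sSup ⟨a, ha, rfl⟩)

theorem map_top [OrderTop A] (he : IsCanonicalExtension e) : e ⊤ = ⊤ := by
  refine top_le_iff.1 (he.le_of_closed_le ?_)
  rintro _ ⟨F, ⟨a, ha⟩, -, rfl⟩ -
  exact (sInf_le (Set.mem_image_of_mem e ha)).trans (e.monotone le_top)

theorem top_mem_trace [OrderTop A] (he : IsCanonicalExtension e) (u : C) : ⊤ ∈ trace e u := by
  rw [mem_trace, he.map_top]
  exact le_top

theorem bot_notMem_trace [OrderBot A] (he : IsCanonicalExtension e) (j : JInf C) :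
    ⊥ ∉ trace e j.1 := by
  rw [mem_trace, he.map_bot]
  intro h
  exact j.2 ∅ (by simpa using h)

end PartialOrder

variable [DistribLattice A] [CompleteLattice C] {e : A ↪o C}

theorem infClosed_trace (he : IsCanonicalExtension e) {k : C} (hk : IsClosedElt e k) :
    InfClosed (trace e k) := by
  obtain ⟨F, hF, hF', rfl⟩ := hk
  intro a ha b hb
  obtain ⟨f, hf, hfa⟩ := (he.sInf_le_iff hF hF').1 ha
  obtain ⟨g, hg, hgb⟩ := (he.sInf_le_iff hF hF').1 hb
  obtain ⟨h, hh, hhf, hhg⟩ := hF' f hf g hg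
  exact (he.sInf_le_iff hF hF').2 ⟨h, hh, le_inf (le_trans hhf hfa) (le_trans hhg hgb)⟩

theorem infClosed_trace_jInf (he : IsCanonicalExtension e) (j : JInf C) :
    InfClosed (trace e j.1) :=
  he.infClosed_trace (he.isClosedElt j)

theorem exists_inf_le (he : IsCanonicalExtension e) {F I : Set A} (hF : F.Nonempty)
    (hF' : DirectedOn (· ≥ ·) F) (hI : I.Nonempty) (hI' : DirectedOn (· ≤ ·) I) {a : A}
    (h : sInf (e '' ((· ⊓ a) '' F)) ≤ sSup (e '' I)) : ∃ f ∈ F, ∃ i ∈ I, f ⊓ a ≤ i := by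
  obtain ⟨_, ⟨f, hf, rfl⟩, i, hi, hfi⟩ := he.compact _ I (hF.image _) (by
    rintro _ ⟨f, hf, rfl⟩ _ ⟨g, hg, rfl⟩
    obtain ⟨h, hh, hhf, hhg⟩ := hF' f hf g hg
    exact ⟨_, ⟨h, hh, rfl⟩, inf_le_inf_right a hhf, inf_le_inf_right a hhg⟩) hI hI' h
  exact ⟨f, hf, i, hi, hfi⟩

/-- Cutting the filter of `j` down by `a` and by `b` gives two closed elements `m a` and `m b` below
`j`. Compactness and distributivity of `A` put `j` below every open element above `m a ⊔ m b`, so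
`j` is their join and, being irreducible, equals one of them. Distributivity of `C` is not needed.
-/
theorem mem_or_mem_trace (he : IsCanonicalExtension e) (j : JInf C) {a b : A}
    (hab : a ⊔ b ∈ trace e j.1) : a ∈ trace e j.1 ∨ b ∈ trace e j.1 := by
  obtain ⟨F, hF, hF', hj⟩ := he.isClosedElt j
  set m : A → C := fun c => sInf (e '' ((· ⊓ c) '' F)) with hm
  have m_le_j : ∀ c, m c ≤ j.1 := by
    intro c
    rw [hj]
    refine le_sInf ?_
    rintro _ ⟨f, hf, rfl⟩
    exact (sInf_le (Set.mem_image_of_mem e (Set.mem_image_of_mem _ hf))).trans (e.monotone (inf_le_left : f ⊓ c ≤ f))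
  have m_le : ∀ c, m c ≤ e c := by
    intro c
    obtain ⟨f, hf⟩ := hF
    exact (sInf_le (Set.mem_image_of_mem e (Set.mem_image_of_mem _ hf))).trans (e.monotone (inf_le_right : f ⊓ c ≤ c))
  have j_le : j.1 ≤ m a ⊔ m b := by
    refine he.le_of_le_open ?_
    rintro _ ⟨I, hI, hI', rfl⟩ ho
    obtain ⟨f, hf, x, hx, hfx⟩ := he.exists_inf_le hF hF' hI hI' (le_sup_left.trans ho)
    obtain ⟨g, hg, y, hy, hgy⟩ := he.exists_inf_le hF hF' hI hI' (le_sup_right.trans ho)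
    rw [mem_trace, hj] at hab
    obtain ⟨h, hh, hhab⟩ := (he.sInf_le_iff hF hF').1 hab
    obtain ⟨p, hp, hpf, hpg⟩ := hF' f hf g hg
    obtain ⟨q, hq, hqp, hqh⟩ := hF' p hp h hh
    obtain ⟨z, hz, hxz, hyz⟩ := hI' x hx y hy
    have hqz : q ≤ z := calc
      q ≤ q ⊓ (a ⊔ b) := le_inf le_rfl (le_trans hqh hhab)
      _ = q ⊓ a ⊔ q ⊓ b := inf_sup_left q a b
      _ ≤ z := sup_le
        ((inf_le_inf_right a (le_trans hqp hpf)).trans (hfx.trans hxz))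
        ((inf_le_inf_right b (le_trans hqp hpg)).trans (hgy.trans hyz))
    rw [hj]
    exact (sInf_le (Set.mem_image_of_mem e hq)).trans ((e.monotone hqz).trans (le_sSup ⟨z, hz, rfl⟩))
  have hjeq : j.1 = sSup {m a, m b} := by
    rw [sSup_pair]
    exact le_antisymm j_le (sup_le (m_le_j a) (m_le_j b))
  rcases j.2 _ hjeq with h | h
  · exact Or.inl (h.trans_le (m_le a))
  · exact Or.inr (h.trans_le (m_le b))

theorem supClosed_compl_trace (he : IsCanonicalExtension e) (j : JInf C) :
    SupClosed (trace e j.1)ᶜ :=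
  fun _ ha _ hb hab => (he.mem_or_mem_trace j hab).elim ha hb

/-- The point is the meet `k` of the prime filter. By compactness `k` is not below the join of `I`,
whereas every element not above `k` is. So any set with join `k` has a member above `k`, hence equal
to it. -/
theorem exists_trace_eq_compl (he : IsCanonicalExtension e) (I : Order.Ideal A)
    (hI : I.IsPrime) : ∃ j : JInf C, trace e j.1 = (I : Set A)ᶜ := by
  have hP : Order.IsPFilter (I : Set A)ᶜ := hI.compl_filter
  have hne : ((I : Set A)ᶜ).Nonempty := hP.toPFilter.nonempty
  have hdir : DirectedOn (· ≥ ·) (I : Set A)ᶜ := hP.toPFilter.directed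
  set k : C := sInf (e '' (I : Set A)ᶜ) with hk
  have hclosed : IsClosedElt e k := ⟨_, hne, hdir, rfl⟩
  have htrace : trace e k = (I : Set A)ᶜ := by
    ext a
    rw [mem_trace, hk, he.sInf_le_iff hne hdir]
    exact ⟨fun ⟨f, hf, hfa⟩ ha => hf (I.lower hfa ha), fun ha => ⟨a, ha, le_rfl⟩⟩
  have hko : ¬ k ≤ sSup (e '' (I : Set A)) := by
    intro h
    obtain ⟨f, hf, i, hi, hfi⟩ := he.compact _ _ hne hdir I.nonempty I.directed h
    exact hf (I.lower hfi hi)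
  refine ⟨⟨k, fun S hS => ?_⟩, htrace⟩
  obtain ⟨s, hs, hso⟩ : ∃ s ∈ S, ¬ s ≤ sSup (e '' (I : Set A)) := by
    by_contra! h
    exact hko (hS.trans_le (sSup_le h))
  have hks : k ≤ s := by
    by_contra hks
    refine hso (he.le_of_closed_le fun l hl hls => ?_)
    have hkl : ¬ k ≤ l := fun h => hks (h.trans hls)
    rw [hl.le_iff_trace_subset, htrace, Set.not_subset] at hkl
    obtain ⟨a, ha, haI⟩ := hkl
    exact (mem_trace.1 ha).trans (le_sSup ⟨a, not_not.1 haI, rfl⟩)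
  rwa [le_antisymm hks (hS ▸ le_sSup hs)]

/-- Prime filter theorem, in terms of completely join-irreducible elements. -/
theorem exists_trace_separating (he : IsCanonicalExtension e) {F I : Set A}
    (hF : F.Nonempty) (hF' : InfClosed F) (hI : I.Nonempty) (hI' : SupClosed I)
    (hFI : ∀ f ∈ F, ∀ i ∈ I, ¬ f ≤ i) :
    ∃ j : JInf C, F ⊆ trace e j.1 ∧ ∀ i ∈ I, i ∉ trace e j.1 := by
  have hup : Order.IsPFilter {a | ∃ f ∈ F, f ≤ a} := by
    refine Order.IsPFilter.of_def (hF.mono fun f hf => ⟨f, hf, le_rfl⟩) ?_ ?_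
    · rintro a ⟨f, hf, hfa⟩ b ⟨g, hg, hgb⟩
      exact ⟨f ⊓ g, ⟨_, hF' hf hg, le_rfl⟩, inf_le_left.trans hfa, inf_le_right.trans hgb⟩
    · rintro a b hab ⟨f, hf, hfa⟩
      exact ⟨f, hf, hfa.trans hab⟩
  have hdown : Order.IsIdeal {a | ∃ i ∈ I, a ≤ i} := by
    refine ⟨?_, hI.mono fun i hi => ⟨i, hi, le_rfl⟩, ?_⟩
    · rintro a b hab ⟨i, hi, hai⟩
      exact ⟨i, hi, le_trans hab hai⟩
    · rintro a ⟨i, hi, hai⟩ b ⟨k, hk, hbk⟩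
      exact ⟨i ⊔ k, ⟨_, hI' hi hk, le_rfl⟩, hai.trans le_sup_left, hbk.trans le_sup_right⟩
  have hdisj : Disjoint (hup.toPFilter : Set A) (hdown.toIdeal : Set A) := by
    refine Set.disjoint_left.2 ?_
    rintro a ⟨f, hf, hfa⟩ ⟨i, hi, hai⟩
    exact hFI f hf i hi (le_trans hfa hai)
  obtain ⟨P, hP, hIP, hFP⟩ := DistribLattice.prime_ideal_of_disjoint_filter_ideal hdisj
  obtain ⟨j, hj⟩ := he.exists_trace_eq_compl P hP
  refine ⟨j, fun f hf => ?_, fun i hi => ?_⟩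
  · rw [hj]
    exact Set.disjoint_left.1 hFP (⟨f, hf, le_rfl⟩ : ∃ g ∈ F, g ≤ f)
  · rw [hj]
    exact not_not.2 (hIP (⟨i, hi, le_rfl⟩ : ∃ k ∈ I, i ≤ k))

theorem le_iff_trace_subset (he : IsCanonicalExtension e) {i j : JInf C} :
    j ≤ i ↔ trace e i.1 ⊆ trace e j.1 :=
  (he.isClosedElt i).le_iff_trace_subset

/-- Since `j` is closed and `diaClosed` is monotone, the join defining `diaSigma` is attained at
`j`. What remains is a meet of meets of elements of `A`. -/
theorem subRel_iff (he : IsCanonicalExtension e) {r : A → A → Prop} {j i : JInf C} :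
    SubRel e r j i ↔ ∀ a ∈ trace e j.1, ∀ b, r a b → b ∈ trace e i.1 := by
  have h1 : diaSigma e r j.1 = diaClosed e r j.1 := by
    refine le_antisymm (sSup_le ?_) (le_sSup ⟨j.1, ⟨he.isClosedElt j, le_rfl⟩, rfl⟩)
    rintro _ ⟨k, ⟨-, hk⟩, rfl⟩
    exact sInf_le_sInf (Set.image_mono fun a (ha : j.1 ≤ e a) => hk.trans ha)
  rw [SubRel, h1]
  simp [diaClosed, dia, trace]

end IsCanonicalExtension

end Trace

/-! ### Meets and joins in images and preimages under a subordination -/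

section Closure

variable {A : Type u}

theorem infClosed_infs [SemilatticeInf A] {s t : Set A} (hs : InfClosed s) (ht : InfClosed t) :
    InfClosed (s ⊼ t) := by
  rintro _ ⟨a, ha, b, hb, rfl⟩ _ ⟨c, hc, d, hd, rfl⟩
  exact ⟨a ⊓ c, hs ha hc, b ⊓ d, ht hb hd, inf_inf_inf_comm a c b d⟩

theorem supClosed_sups [SemilatticeSup A] {s t : Set A} (hs : SupClosed s) (ht : SupClosed t) :
    SupClosed (s ⊻ t) := by
  rintro _ ⟨a, ha, b, hb, rfl⟩ _ ⟨c, hc, d, hd, rfl⟩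
  exact ⟨a ⊔ c, hs ha hc, b ⊔ d, ht hb hd, sup_sup_sup_comm a c b d⟩

/-- The image of a set under a relation. -/
def relImage (r : A → A → Prop) (s : Set A) : Set A := {b | ∃ a ∈ s, r a b}

/-- The preimage of a set under a relation. -/
def relPreimage (r : A → A → Prop) (s : Set A) : Set A := {a | ∃ b ∈ s, r a b}

namespace IsSubordination

variable [DistribLattice A] [BoundedOrder A] {r : A → A → Prop}

theorem rel_bot (hr : IsSubordination r) (x : A) : r ⊥ x := hr.wo _ _ _ hr.bot bot_le

theorem rel_top (hr : IsSubordination r) (x : A) : r x ⊤ := hr.si _ _ _ le_top hr.top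

theorem infClosed_relImage (hr : IsSubordination r) {s : Set A} (hs : InfClosed s) :
    InfClosed (relImage r s) := by
  rintro x ⟨a, ha, hax⟩ y ⟨b, hb, hby⟩
  exact ⟨a ⊓ b, hs ha hb, hr.and _ _ _ (hr.si _ _ _ inf_le_left hax)
    (hr.si _ _ _ inf_le_right hby)⟩

theorem supClosed_relPreimage (hr : IsSubordination r) {s : Set A} (hs : SupClosed s) :
    SupClosed (relPreimage r s) := by
  rintro x ⟨a, ha, hxa⟩ y ⟨b, hb, hyb⟩
  exact ⟨a ⊔ b, hs ha hb, hr.or _ _ _ (hr.wo _ _ _ hxa le_sup_left)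
    (hr.wo _ _ _ hyb le_sup_right)⟩

theorem relImage_nonempty (hr : IsSubordination r) {s : Set A} (hs : s.Nonempty) :
    (relImage r s).Nonempty :=
  let ⟨a, ha⟩ := hs
  ⟨⊤, a, ha, hr.rel_top a⟩

theorem relPreimage_nonempty (hr : IsSubordination r) {s : Set A} (hs : s.Nonempty) :
    (relPreimage r s).Nonempty :=
  let ⟨a, ha⟩ := hs
  ⟨⊥, a, ha, hr.rel_bot a⟩

end IsSubordination

end Closure

/-! ### The four correspondences -/

section Correspondence

variable {A : Type u} {C : Type v} [DistribLattice A] [BoundedOrder A] [CompleteLattice C]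
  {e : A ↪o C} {r : A → A → Prop}

namespace IsCanonicalExtension

theorem compl_trace_nonempty (he : IsCanonicalExtension e) (j : JInf C) :
    (trace e j.1)ᶜ.Nonempty :=
  ⟨⊥, he.bot_notMem_trace j⟩

theorem trace_nonempty (he : IsCanonicalExtension e) (j : JInf C) : (trace e j.1).Nonempty :=
  ⟨⊤, he.top_mem_trace j.1⟩

/-- A predecessor of `i` whose trace contains a given filter base. -/
theorem exists_subRel_left (he : IsCanonicalExtension e) (hr : IsSubordination r) {F : Set A}
    (hF : F.Nonempty) (hF' : InfClosed F) (i : JInf C)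
    (h : ∀ f ∈ F, ∀ b, r f b → b ∈ trace e i.1) :
    ∃ j : JInf C, F ⊆ trace e j.1 ∧ SubRel e r j i := by
  -- Avoiding the preimage of the complement of the trace of `i` is exactly `j R i`.
  obtain ⟨j, hj, hj'⟩ := he.exists_trace_separating hF hF'
    (hr.relPreimage_nonempty (he.compl_trace_nonempty i))
    (hr.supClosed_relPreimage (he.supClosed_compl_trace i))
    (by rintro f hf x ⟨b, hb, hxb⟩ hfx
        exact hb (h f hf b (hr.si _ _ _ hfx hxb)))
  exact ⟨j, hj, he.subRel_iff.2 fun a ha b hab => by_contra fun hb => hj' a ⟨b, hb, hab⟩ ha⟩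

/-- A successor of `j` whose trace avoids a given ideal base. -/
theorem exists_subRel_right (he : IsCanonicalExtension e) (hr : IsSubordination r) {I : Set A}
    (hI : I.Nonempty) (hI' : SupClosed I) (j : JInf C)
    (h : ∀ x ∈ I, ∀ a ∈ trace e j.1, ¬ r a x) :
    ∃ i : JInf C, SubRel e r j i ∧ ∀ x ∈ I, x ∉ trace e i.1 := by
  -- Containing the image of the trace of `j` is exactly `j R i`.
  obtain ⟨i, hi, hi'⟩ := he.exists_trace_separating
    (hr.relImage_nonempty (he.trace_nonempty j))
    (hr.infClosed_relImage (he.infClosed_trace_jInf j)) hI hI'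
    (by rintro b ⟨a, ha, hab⟩ x hx hbx
        exact h x hx a ha (hr.wo _ _ _ hab hbx))
  exact ⟨i, he.subRel_iff.2 fun a ha b hab => hi ⟨a, ha, hab⟩, hi'⟩

theorem exists_mem_subRel (he : IsCanonicalExtension e) (hr : IsSubordination r) {a : A}
    (i : JInf C) (h : ∀ b, r a b → b ∈ trace e i.1) :
    ∃ j : JInf C, a ∈ trace e j.1 ∧ SubRel e r j i := by
  obtain ⟨j, hj, hji⟩ := he.exists_subRel_left hr (Set.singleton_nonempty a)
    infClosed_singleton i (by rintro _ rfl; exact h)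
  exact ⟨j, hj rfl, hji⟩

theorem exists_subRel_notMem (he : IsCanonicalExtension e) (hr : IsSubordination r) {b : A}
    (j : JInf C) (h : ∀ a ∈ trace e j.1, ¬ r a b) :
    ∃ i : JInf C, SubRel e r j i ∧ b ∉ trace e i.1 := by
  obtain ⟨i, hji, hi⟩ := he.exists_subRel_right hr (Set.singleton_nonempty b)
    supClosed_singleton j (by rintro _ rfl; exact h)
  exact ⟨i, hji, hi b rfl⟩

/-- The conditions `k ≤ j` and `j R k` say that the trace of `k` contains the trace of `j` and its
`≺`-image. (CT) makes the meets of such elements compatible with `k R i`. -/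
theorem ct_iff (he : IsCanonicalExtension e) (hr : IsSubordination r) :
    CT r ↔ ∀ j i : JInf C, SubRel e r j i →
      ∃ k : JInf C, k ≤ j ∧ SubRel e r j k ∧ SubRel e r k i := by
  constructor
  · intro hct j i hji
    rw [he.subRel_iff] at hji
    obtain ⟨k, hk, hki⟩ := he.exists_subRel_left hr
      ((he.trace_nonempty j).infs (hr.relImage_nonempty (he.trace_nonempty j)))
      (infClosed_infs (he.infClosed_trace_jInf j)
        (hr.infClosed_relImage (he.infClosed_trace_jInf j))) i (by
      rintro _ ⟨a, ha, b, ⟨a', ha', hab⟩, rfl⟩ c hc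
      -- Replacing `a` and `a'` by `a ⊓ a'`, still in the trace of `j`, lets both premises of (CT)
      -- share one element.
      refine hji _ (he.infClosed_trace_jInf j ha ha') c (hct _ b _ ?_ ?_)
      · exact hr.si _ _ _ inf_le_right hab
      · exact hr.si _ _ _ (inf_le_inf_right b inf_le_left) hc)
    refine ⟨k, he.le_iff_trace_subset.2 fun a ha => ?_, he.subRel_iff.2 fun a ha b hab => ?_, hki⟩
    · exact isUpperSet_trace e k.1 inf_le_left
        (hk (Set.inf_mem_infs ha ⟨a, ha, hr.rel_top a⟩))
    · exact isUpperSet_trace e k.1 inf_le_right (hk (Set.inf_mem_infs ha ⟨a, ha, hab⟩))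
  · intro h a b c hab hc
    by_contra hac
    obtain ⟨j, hj, hj'⟩ := he.exists_trace_separating (Set.singleton_nonempty a)
      infClosed_singleton (hr.relPreimage_nonempty (Set.singleton_nonempty c))
      (hr.supClosed_relPreimage supClosed_singleton) (by
        rintro _ rfl x ⟨_, rfl, hx⟩ hax
        exact hac (hr.si _ _ _ hax hx))
    obtain ⟨i, hji, hi⟩ := he.exists_subRel_notMem hr (b := c) j
      fun x hx hxc => hj' x ⟨c, rfl, hxc⟩ hx
    obtain ⟨k, hkj, hjk, hki⟩ := h j i hji
    rw [he.subRel_iff] at hjk hki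
    exact hi (hki _ (he.infClosed_trace_jInf k (he.le_iff_trace_subset.1 hkj (hj rfl))
      (hjk a (hj rfl) b hab)) c hc)

/-- The conditions `i₁ ≤ j` and `j R i₂` say that the trace of `j` avoids the complement of the
trace of `i₁` and the preimage of that of `i₂`; the left-to-right half of (S9) separates their joins
from `i₃`. -/
theorem s9_iff (he : IsCanonicalExtension e) (hr : IsSubordination r) :
    S9 r ↔ ∀ i₁ i₂ i₃ : JInf C, (SubRel e r i₃ i₁ ∧ SubRel e r i₃ i₂) ↔
      ∃ j : JInf C, i₁ ≤ j ∧ SubRel e r j i₂ ∧ SubRel e r i₃ j := by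
  constructor
  · intro hs i₁ i₂ i₃
    constructor
    · rintro ⟨h1, h2⟩
      rw [he.subRel_iff] at h1 h2
      obtain ⟨j, hj, hj'⟩ := he.exists_subRel_right hr
        ((he.compl_trace_nonempty i₁).sups
          (hr.relPreimage_nonempty (he.compl_trace_nonempty i₂)))
        (supClosed_sups (he.supClosed_compl_trace i₁)
          (hr.supClosed_relPreimage (he.supClosed_compl_trace i₂))) i₃ (by
        rintro _ ⟨a, ha, c, ⟨b, hb, hcb⟩, rfl⟩ p hp hpac
        obtain ⟨a', b', haa, hbb, hpab⟩ := (hs a b p).1 ⟨c, hcb, hpac⟩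
        rcases he.mem_or_mem_trace i₃ (isUpperSet_trace e _ hpab hp) with h | h
        · exact ha (h1 a' h a haa)
        · exact hb (h2 b' h b hbb))
      refine ⟨j, he.le_iff_trace_subset.2 fun a ha => ?_,
        he.subRel_iff.2 fun c hc b hcb => ?_, hj⟩
      · by_contra ha'
        refine hj' _ (Set.sup_mem_sups ha' ⟨⊥, he.bot_notMem_trace i₂, hr.bot⟩) ?_
        exact isUpperSet_trace e _ le_sup_left ha
      · by_contra hb
        refine hj' _ (Set.sup_mem_sups (he.bot_notMem_trace i₁) ⟨b, hb, hcb⟩) ?_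
        exact isUpperSet_trace e _ le_sup_right hc
    · rintro ⟨j, h1j, hj2, h3j⟩
      rw [he.le_iff_trace_subset] at h1j
      rw [he.subRel_iff] at hj2 h3j
      refine ⟨he.subRel_iff.2 fun a ha b hab => h1j (h3j a ha b hab),
        he.subRel_iff.2 fun a ha b hab => ?_⟩
      -- With `⊥` in the first place, the right-to-left half of (S9) is interpolation: `a ≺ b` gives
      -- `a ≺ c ≺ b`.
      obtain ⟨c, hcb, hac⟩ := (hs ⊥ b a).2 ⟨⊥, a, hr.bot, hab, le_sup_right⟩
      rw [bot_sup_eq] at hac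
      exact hj2 c (h3j a ha c hac) b hcb
  · intro h a b x
    constructor
    · rintro ⟨c, hcb, hxac⟩
      by_contra! hno
      -- Since `⊥ ≺ a` and `⊥ ≺ b`, avoiding all joins `a' ⊔ b'` also keeps out every element `≺ a`
      -- and every element `≺ b`.
      obtain ⟨i₃, h3, h3'⟩ := he.exists_trace_separating (Set.singleton_nonempty x)
        infClosed_singleton
        ((hr.relPreimage_nonempty (Set.singleton_nonempty a)).sups
          (hr.relPreimage_nonempty (Set.singleton_nonempty b)))
        (supClosed_sups (hr.supClosed_relPreimage supClosed_singleton)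
          (hr.supClosed_relPreimage supClosed_singleton)) (by
          rintro _ rfl _ ⟨a', ⟨_, rfl, ha⟩, b', ⟨_, rfl, hb⟩, rfl⟩
          exact hno a' b' ha hb)
      obtain ⟨i₁, h31, h1⟩ := he.exists_subRel_notMem hr (b := a) i₃ fun y hy hya =>
        h3' _ (Set.sup_mem_sups ⟨a, rfl, hya⟩ ⟨b, rfl, hr.rel_bot b⟩)
          (isUpperSet_trace e _ le_sup_left hy)
      obtain ⟨i₂, h32, h2⟩ := he.exists_subRel_notMem hr (b := b) i₃ fun y hy hyb =>
        h3' _ (Set.sup_mem_sups ⟨a, rfl, hr.rel_bot a⟩ ⟨b, rfl, hyb⟩)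
          (isUpperSet_trace e _ le_sup_right hy)
      obtain ⟨j, h1j, hj2, h3j⟩ := (h i₁ i₂ i₃).1 ⟨h31, h32⟩
      rw [he.le_iff_trace_subset] at h1j
      rw [he.subRel_iff] at hj2 h3j
      rcases he.mem_or_mem_trace j (h3j x (h3 rfl) _ hxac) with hm | hm
      · exact h1 (h1j hm)
      · exact h2 (hj2 c hm b hcb)
    · rintro ⟨a', b', haa, hbb, hx⟩
      by_contra! hno
      obtain ⟨j, hj, hj'⟩ := he.exists_trace_separating
        (hr.relImage_nonempty (Set.singleton_nonempty x))
        (hr.infClosed_relImage infClosed_singleton)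
        ((Set.singleton_nonempty a).sups (hr.relPreimage_nonempty (Set.singleton_nonempty b)))
        (supClosed_sups supClosed_singleton (hr.supClosed_relPreimage supClosed_singleton)) (by
          rintro y ⟨_, rfl, hxy⟩ _ ⟨_, rfl, c, ⟨_, rfl, hcb⟩, rfl⟩ hy
          exact hno c hcb (hr.wo _ _ _ hxy hy))
      obtain ⟨i₂, hj2, h2⟩ := he.exists_subRel_notMem hr (b := b) j fun y hy hyb =>
        hj' _ (Set.sup_mem_sups rfl ⟨b, rfl, hyb⟩) (isUpperSet_trace e _ le_sup_right hy)
      obtain ⟨i₃, h3, h3j⟩ := he.exists_mem_subRel hr (a := x) j fun y hy => hj ⟨x, rfl, hy⟩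
      -- Taking `i₁ = j` reduces the right-hand side to `i₃ R j R i₂`, so the equivalence yields
      -- transitivity of `R` here.
      obtain ⟨-, h32⟩ := (h j i₂ i₃).2 ⟨j, le_rfl, hj2, h3j⟩
      rw [he.subRel_iff] at h3j h32
      rcases he.mem_or_mem_trace i₃ (isUpperSet_trace e _ hx h3) with hm | hm
      · exact hj' _ (Set.sup_mem_sups rfl ⟨b, rfl, hr.rel_bot b⟩)
          (isUpperSet_trace e _ le_sup_left (h3j a' hm a haa))
      · exact h2 (h32 b' hm b hbb)

/-- Being above `i₁` and `i₂` means avoiding all joins of a non-member of one trace with a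
non-member of the other. (SL1) moves such a join back to the prime filter of `i₄`, where primeness
splits it. -/
theorem sl1_iff (he : IsCanonicalExtension e) (hr : IsSubordination r) :
    SL1 r ↔ ∀ i₁ i₂ i₃ i₄ : JInf C, SubRel e r i₄ i₁ → SubRel e r i₄ i₂ → SubRel e r i₃ i₄ →
      ∃ j : JInf C, (i₁ : C) ⊔ (i₂ : C) ≤ (j : C) ∧ SubRel e r i₃ j := by
  constructor
  · intro hs i₁ i₂ i₃ i₄ h1 h2 h3
    rw [he.subRel_iff] at h1 h2 h3
    obtain ⟨j, hj, hj'⟩ := he.exists_subRel_right hr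
      ((he.compl_trace_nonempty i₁).sups (he.compl_trace_nonempty i₂))
      (supClosed_sups (he.supClosed_compl_trace i₁) (he.supClosed_compl_trace i₂)) i₃ (by
      rintro _ ⟨b, hb, c, hc, rfl⟩ p hp hpbc
      obtain ⟨b', c', hbb, hcc, hpbc'⟩ := hs p b c hpbc
      rcases he.mem_or_mem_trace i₄ (h3 p hp _ hpbc') with h | h
      · exact hb (h1 b' h b hbb)
      · exact hc (h2 c' h c hcc))
    refine ⟨j, sup_le ?_ ?_, hj⟩
    · refine (he.isClosedElt j).le_iff_trace_subset.2 fun a ha => by_contra fun ha' => ?_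
      exact hj' _ (Set.sup_mem_sups ha' (he.bot_notMem_trace i₂))
        (isUpperSet_trace e _ le_sup_left ha)
    · refine (he.isClosedElt j).le_iff_trace_subset.2 fun a ha => by_contra fun ha' => ?_
      exact hj' _ (Set.sup_mem_sups (he.bot_notMem_trace i₁) ha')
        (isUpperSet_trace e _ le_sup_right ha)
  · intro h a b c habc
    by_contra! hno
    obtain ⟨i₄, h4, h4'⟩ := he.exists_trace_separating
      (hr.relImage_nonempty (Set.singleton_nonempty a))
      (hr.infClosed_relImage infClosed_singleton)
      ((hr.relPreimage_nonempty (Set.singleton_nonempty b)).sups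
        (hr.relPreimage_nonempty (Set.singleton_nonempty c)))
      (supClosed_sups (hr.supClosed_relPreimage supClosed_singleton)
        (hr.supClosed_relPreimage supClosed_singleton)) (by
        rintro y ⟨_, rfl, hay⟩ _ ⟨b', ⟨_, rfl, hb⟩, c', ⟨_, rfl, hc⟩, rfl⟩ hy
        exact hno b' c' hb hc (hr.wo _ _ _ hay hy))
    obtain ⟨i₁, h41, h1⟩ := he.exists_subRel_notMem hr (b := b) i₄ fun y hy hyb =>
      h4' _ (Set.sup_mem_sups ⟨b, rfl, hyb⟩ ⟨c, rfl, hr.rel_bot c⟩)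
        (isUpperSet_trace e _ le_sup_left hy)
    obtain ⟨i₂, h42, h2⟩ := he.exists_subRel_notMem hr (b := c) i₄ fun y hy hyc =>
      h4' _ (Set.sup_mem_sups ⟨b, rfl, hr.rel_bot b⟩ ⟨c, rfl, hyc⟩)
        (isUpperSet_trace e _ le_sup_right hy)
    obtain ⟨i₃, h3, h34⟩ := he.exists_mem_subRel hr (a := a) i₄ fun y hy => h4 ⟨a, rfl, hy⟩
    obtain ⟨j, hj, h3j⟩ := h i₁ i₂ i₃ i₄ h41 h42 h34
    rw [he.subRel_iff] at h3j
    rcases he.mem_or_mem_trace j (h3j a h3 _ habc) with hm | hm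
    · exact h1 (le_sup_left.trans (hj.trans hm))
    · exact h2 (le_sup_right.trans (hj.trans hm))

/-- The order dual of the argument for (SL1): meets of members of the two traces replace joins of
non-members, and closure of the trace of `i₄` under meets replaces primeness. -/
theorem sl2_iff (he : IsCanonicalExtension e) (hr : IsSubordination r) :
    SL2 r ↔ ∀ i₁ i₂ i₃ i₄ : JInf C, SubRel e r i₁ i₄ → SubRel e r i₂ i₄ → SubRel e r i₄ i₃ →
      ∃ j : JInf C, (j : C) ≤ (i₁ : C) ⊓ (i₂ : C) ∧ SubRel e r j i₃ := by
  constructor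
  · intro hs i₁ i₂ i₃ i₄ h1 h2 h3
    rw [he.subRel_iff] at h1 h2 h3
    obtain ⟨j, hj, hj3⟩ := he.exists_subRel_left hr
      ((he.trace_nonempty i₁).infs (he.trace_nonempty i₂))
      (infClosed_infs (he.infClosed_trace_jInf i₁) (he.infClosed_trace_jInf i₂)) i₃ (by
      rintro _ ⟨b, hb, c, hc, rfl⟩ y hy
      obtain ⟨b', c', hbb, hcc, hy'⟩ := hs y b c hy
      exact h3 _ (he.infClosed_trace_jInf i₄ (h1 b hb b' hbb) (h2 c hc c' hcc)) y hy')
    refine ⟨j, le_inf ?_ ?_, hj3⟩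
    · refine (he.isClosedElt i₁).le_iff_trace_subset.2 fun a ha => ?_
      exact isUpperSet_trace e _ inf_le_left
        (hj (Set.inf_mem_infs ha (he.top_mem_trace i₂.1)))
    · refine (he.isClosedElt i₂).le_iff_trace_subset.2 fun a ha => ?_
      exact isUpperSet_trace e _ inf_le_right
        (hj (Set.inf_mem_infs (he.top_mem_trace i₁.1) ha))
  · intro h a b c hbca
    by_contra! hno
    -- As `b ≺ ⊤` and `c ≺ ⊤`, the trace of `i₄` contains everything `≺`-above `b` or `c`, which
    -- yields the predecessors `i₁` and `i₂`.
    obtain ⟨i₄, h4, h4'⟩ := he.exists_trace_separating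
      ((hr.relImage_nonempty (Set.singleton_nonempty b)).infs
        (hr.relImage_nonempty (Set.singleton_nonempty c)))
      (infClosed_infs (hr.infClosed_relImage infClosed_singleton)
        (hr.infClosed_relImage infClosed_singleton))
      (hr.relPreimage_nonempty (Set.singleton_nonempty a))
      (hr.supClosed_relPreimage supClosed_singleton) (by
        rintro _ ⟨b', ⟨_, rfl, hb⟩, c', ⟨_, rfl, hc⟩, rfl⟩ y ⟨_, rfl, hy⟩ hle
        exact hno b' c' hb hc (hr.si _ _ _ hle hy))
    obtain ⟨i₃, h43, h3⟩ := he.exists_subRel_notMem hr (b := a) i₄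
      fun y hy hya => h4' y ⟨a, rfl, hya⟩ hy
    obtain ⟨i₁, h1, h14⟩ := he.exists_mem_subRel hr (a := b) i₄ fun y hy =>
      isUpperSet_trace e _ inf_le_left
        (h4 (Set.inf_mem_infs ⟨b, rfl, hy⟩ ⟨c, rfl, hr.rel_top c⟩))
    obtain ⟨i₂, h2, h24⟩ := he.exists_mem_subRel hr (a := c) i₄ fun y hy =>
      isUpperSet_trace e _ inf_le_right
        (h4 (Set.inf_mem_infs ⟨b, rfl, hr.rel_top b⟩ ⟨c, rfl, hy⟩))
    obtain ⟨j, hj, hj3⟩ := h i₁ i₂ i₃ i₄ h14 h24 h43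
    rw [he.subRel_iff] at hj3
    exact h3 (hj3 _ (he.infClosed_trace_jInf j (hj.trans (inf_le_left.trans h1))
      (hj.trans (inf_le_right.trans h2))) a hbca)

end IsCanonicalExtension

end Correspondence

end SubordinationLattice

theorem mainTheorem4 {A : Type*} [DistribLattice A] [BoundedOrder A]
    (r : A → A → Prop) (hr : SubordinationLattice.IsSubordination r)
    {C : Type*} [CompleteLattice C] (e : A ↪o C)
    (he : SubordinationLattice.IsCanonicalExtension e) :
    (SubordinationLattice.CT r ↔
      ∀ j i : SubordinationLattice.JInf C, SubordinationLattice.SubRel e r j i →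
        ∃ k : SubordinationLattice.JInf C, k ≤ j ∧
          SubordinationLattice.SubRel e r j k ∧ SubordinationLattice.SubRel e r k i) ∧
    (SubordinationLattice.S9 r ↔
      ∀ i₁ i₂ i₃ : SubordinationLattice.JInf C,
        (SubordinationLattice.SubRel e r i₃ i₁ ∧ SubordinationLattice.SubRel e r i₃ i₂) ↔
        ∃ j : SubordinationLattice.JInf C, i₁ ≤ j ∧
          SubordinationLattice.SubRel e r j i₂ ∧ SubordinationLattice.SubRel e r i₃ j) ∧
    (SubordinationLattice.SL1 r ↔
      ∀ i₁ i₂ i₃ i₄ : SubordinationLattice.JInf C,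
        SubordinationLattice.SubRel e r i₄ i₁ → SubordinationLattice.SubRel e r i₄ i₂ →
        SubordinationLattice.SubRel e r i₃ i₄ →
        ∃ j : SubordinationLattice.JInf C, (i₁ : C) ⊔ (i₂ : C) ≤ (j : C) ∧
          SubordinationLattice.SubRel e r i₃ j) ∧
    (SubordinationLattice.SL2 r ↔
      ∀ i₁ i₂ i₃ i₄ : SubordinationLattice.JInf C,
        SubordinationLattice.SubRel e r i₁ i₄ → SubordinationLattice.SubRel e r i₂ i₄ →
        SubordinationLattice.SubRel e r i₄ i₃ →
        ∃ j : SubordinationLattice.JInf C, (j : C) ≤ (i₁ : C) ⊓ (i₂ : C) ∧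
          SubordinationLattice.SubRel e r j i₃) :=
  ⟨he.ct_iff hr, he.s9_iff hr, he.sl1_iff hr, he.sl2_iff hr⟩
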